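/- Let $d \ge 3$ and let $\mathcal K \subseteq \mathbb R^d$ be a polyhedral convex cone (the solution set of finitely many homogeneous linear equalities and inequalities) that is self-dual, i.e. there is an inner product $\langle\cdot,\cdot\rangle$ on $\mathbb R^d$ such that $\mathcal K$ equals its dual cone $\mathcal K^* = \{y \in \mathbb R^d : \langle x,y\rangle \ge 0 \text{ for all } x\in\mathcal K\}$. Suppose that $\mathcal K$ is not simplicial, i.e. it is not generated by a finite linearly independent set (equivalently, it is not linearly isomorphic to a nonnegative orthant). Then no slack matrix of $\mathcal K$ that is positive semidefinite is completely positive semidefinite. In particular, this applies if $\mathcal K$ is irreducible: an irreducible such $\mathcal K$ is not simplicial, and hence none of its positive semidefinite slack matrices is completely positive semidefinite. Here: - An extreme ray of a convex cone $C$ is a face of $C$ of the form $\{\alpha x : \alpha\ge 0\}$ with $x\neq 0$; one says that $x$ generates it. - A slack matrix of $\mathcal K$ is a matrix $M\in\mathbb R^{n\times m}$ with $M_{ij} = \langle x_i, y_j\rangle$, where $\langle\cdot,\cdot\rangle$ is some inner product on $\mathbb R^d$, $x_1,\dots,x_n$ consist of exactly one generator for each extreme ray of $\mathcal K$, and $y_1,\dots,y_m$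 of exactly one generator for each extreme ray of the dual cone of $\mathcal K$ with respect to that inner product. - A matrix $M \in \mathbb R^{n\times n}$ is positive semidefinite if it is symmetric and $v^{\mathsf T} M v \ge 0$ for all $v\in\mathbb R^n$. It is completely positive semidefinite if there are some $k$ and symmetric positive semidefinite matrices $A_1,\dots,A_n\in\mathbb R^{k\times k}$ with $M_{ij} = \operatorname{tr}(A_iA_j)$ for all $i,j$. - $\mathcal K$ is irreducible if it cannot be written as $\mathcal K_1+\mathcal K_2$ with nonzero closed convex cones $\mathcal K_1,\mathcal K_2$ such that $\operatorname{span}\mathcal K_1\cap\operatorname{span}\mathcal K_2=\{0\}$. -/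

import Mathlib

namespace ConeSlack

/-- An inner product on a real vector space: a symmetric positive definite bilinear form. -/
def IsInnerProduct {E : Type*} [AddCommGroup E] [Module ℝ E] (B : LinearMap.BilinForm ℝ E) :
    Prop :=
  (∀ x y, B x y = B y x) ∧ ∀ x, x ≠ 0 → 0 < B x x

/-- The cone is the solution set of finitely many homogeneous linear inequalities `0 ≤ f x`
(a linear equality is a pair of inequalities). -/
def IsPolyhedral {E : Type*} [AddCommGroup E] [Module ℝ E] (K : PointedCone ℝ E) : Prop :=
  K.DualFG (LinearMap.id : Module.Dual ℝ E →ₗ[ℝ] Module.Dual ℝ E)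

/-- The cone equals its dual cone `{y | ∀ x ∈ K, 0 ≤ B x y}` for some inner product `B`. -/
def IsSelfDual {E : Type*} [AddCommGroup E] [Module ℝ E] (K : PointedCone ℝ E) : Prop :=
  ∃ B : LinearMap.BilinForm ℝ E, IsInnerProduct B ∧ PointedCone.dual B (K : Set E) = K

/-- An extreme ray of `K`: a face of the form `{α • x | 0 ≤ α}` with `x ≠ 0`. -/
def IsExtremeRay {E : Type*} [AddCommGroup E] [Module ℝ E] (K R : PointedCone ℝ E) : Prop :=
  R.IsFaceOf K ∧ ∃ x : E, x ≠ 0 ∧ R = PointedCone.hull ℝ {x}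

/-- The family `x` consists of one generator for each extreme ray of `K`. -/
def GeneratesExtremeRays {E ι : Type*} [AddCommGroup E] [Module ℝ E] (K : PointedCone ℝ E)
    (x : ι → E) : Prop :=
  Set.BijOn (fun i => PointedCone.hull ℝ {x i}) Set.univ {R | IsExtremeRay K R}

/-- `M` is a slack matrix of `K`: for some inner product `B`, its entries are `B (x i) (y j)`, where
`x` and `y` list one generator for each extreme ray of `K` and of the dual cone of `K`.
(This is meant for pointed full-dimensional polyhedral cones, such as self-dual ones.) -/
def IsSlackMatrix {E : Type*} [AddCommGroup E] [Module ℝ E] (K : PointedCone ℝ E) {n m : ℕ}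
    (M : Matrix (Fin n) (Fin m) ℝ) : Prop :=
  ∃ B : LinearMap.BilinForm ℝ E, IsInnerProduct B ∧
    ∃ (x : Fin n → E) (y : Fin m → E),
      GeneratesExtremeRays K x ∧
      GeneratesExtremeRays (PointedCone.dual B (K : Set E)) y ∧
      ∀ i j, M i j = B (x i) (y j)

/-- `M` is the Gram matrix, for the trace inner product, of real positive semidefinite matrices of
some common size. -/
def IsCompletelyPosSemidef {n : ℕ} (M : Matrix (Fin n) (Fin n) ℝ) : Prop :=
  ∃ (k : ℕ) (A : Fin n → Matrix (Fin k) (Fin k) ℝ),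
    (∀ i, (A i).PosSemidef) ∧ ∀ i j, M i j = (A i * A j).trace

/-- `K` is not the sum of two nonzero closed convex cones whose spans intersect trivially. -/
def IsIrreducible {E : Type*} [AddCommGroup E] [Module ℝ E] [TopologicalSpace E]
    (K : PointedCone ℝ E) : Prop :=
  ¬ ∃ K₁ K₂ : PointedCone ℝ E,
    IsClosed (K₁ : Set E) ∧ IsClosed (K₂ : Set E) ∧ K₁ ≠ ⊥ ∧ K₂ ≠ ⊥ ∧
    Submodule.span ℝ (K₁ : Set E) ⊓ Submodule.span ℝ (K₂ : Set E) = ⊥ ∧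
    K = K₁ ⊔ K₂

end ConeSlack

/-! Suppose a slack matrix factors as `B (x i) (y j) = tr (A i * A j)` with `A i` positive
semidefinite. As the `x i` span, `x i ↦ A i` extends to a linear map `L`
(`exists_linearMap_of_gram`). A zero entry forces `A i * A j = 0`, and the `x i` orthogonal to `y j`
span its hyperplane (`mem_span_of_apply_eq_zero`), so `L v * A j = 0` whenever `v` is orthogonal to
`y j`. Hence `A i = α • A j + W` with `W * A j = 0`. If an off-diagonal entry were nonzero, this
would hold with `i`, `j` exchanged too, both coefficients being positive; this forces `W = 0` and
makes `y i`, `y j` generate the same ray. So the matrix is diagonal (`apply_eq_zero_of_ne`), and the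
generators `x i` are linearly independent. Self-duality enters only through `K` being salient and
spanning, so the slack matrix may use a different inner product. Irreducible cones are covered
because a simplicial spanning cone of dimension at least two splits. -/

open Filter Topology

namespace ConeSlack

/-! ### Extreme rays and facets of polyhedral cones -/

section Cones

variable {E : Type*} [AddCommGroup E] [Module ℝ E]

lemma mem_hull_singleton {x z : E} : z ∈ PointedCone.hull ℝ {x} ↔ ∃ c : ℝ, 0 ≤ c ∧ c • x = z := by
  rw [Submodule.mem_span_singleton]
  exact ⟨fun ⟨c, h⟩ => ⟨c, c.2, h⟩, fun ⟨c, hc, h⟩ => ⟨⟨c, hc⟩, h⟩⟩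

/-- Moving from a point of a polyhedral salient cone in the direction opposite to a nonzero element
of the cone, one hits a facet. -/
lemma exists_sub_smul_mem_dual {S : Finset (Module.Dual ℝ E)}
    (hsal : ∀ z, (∀ f ∈ S, 0 ≤ f z) → (∀ f ∈ S, 0 ≤ f (-z)) → z = 0) {x w : E}
    (hx : ∀ f ∈ S, 0 ≤ f x) (hw : ∀ f ∈ S, 0 ≤ f w) (hw0 : w ≠ 0) :
    ∃ t : ℝ, 0 ≤ t ∧ (∀ f ∈ S, 0 ≤ f (x - t • w)) ∧ ∃ f ∈ S, 0 < f w ∧ f (x - t • w) = 0 := by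
  classical
  have hne : (S.filter fun f => 0 < f w).Nonempty := by
    by_contra h
    rw [Finset.not_nonempty_iff_eq_empty, Finset.filter_eq_empty_iff] at h
    refine hw0 (hsal w hw fun f hf => ?_)
    have := h hf
    rw [map_neg]
    linarith
  -- The smallest ratio `f x / f w` is the first time a constraint becomes tight.
  obtain ⟨g, hg, hmin⟩ := Finset.exists_min_image _ (fun f => f x / f w) hne
  rw [Finset.mem_filter] at hg
  refine ⟨g x / g w, div_nonneg (hx g hg.1) hg.2.le, fun f hf => ?_, g, hg.1, hg.2, ?_⟩
  · rw [map_sub, map_smul, smul_eq_mul, sub_nonneg]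
    rcases (hw f hf).eq_or_lt with h | h
    · simpa [← h] using hx f hf
    · rw [← le_div_iff₀ h]
      exact hmin f (Finset.mem_filter.2 ⟨hf, h⟩)
  · have := hg.2.ne'
    rw [map_sub, map_smul, smul_eq_mul]
    field_simp
    ring

/-- A polyhedral salient cone is generated by its extreme rays. -/
theorem IsPolyhedral.le_of_extremeRay_le {K C : PointedCone ℝ E} (hK : IsPolyhedral K)
    (hsal : ∀ z ∈ K, -z ∈ K → z = 0) (hC : ∀ R, IsExtremeRay K R → R ≤ C) : K ≤ C := by
  classical
  obtain ⟨S, rfl⟩ := hK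
  have hmem : ∀ z, z ∈ PointedCone.dual (LinearMap.id : Module.Dual ℝ E →ₗ[ℝ] Module.Dual ℝ E)
      (S : Set (Module.Dual ℝ E)) ↔ ∀ f ∈ S, 0 ≤ f z := fun z => Iff.rfl
  simp only [hmem] at hsal
  -- Induction on the number of constraints that are not tight at `x`.
  suffices H : ∀ (n : ℕ) (x : E), (∀ f ∈ S, 0 ≤ f x) → (S.filter fun f => f x ≠ 0).card = n →
      x ∈ C from fun x hx => H _ x hx rfl
  intro n
  induction n using Nat.strong_induction_on with
  | _ n ih =>
  intro x hx hn
  have key : ∀ u, (∀ f ∈ S, 0 ≤ f u) → (∀ f ∈ S, f x = 0 → f u = 0) →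
      (∃ f ∈ S, f x ≠ 0 ∧ f u = 0) → u ∈ C := by
    rintro u hu hxu ⟨f, hf, hfx, hfu⟩
    refine ih _ ?_ u hu rfl
    rw [← hn]
    refine Finset.card_lt_card (Finset.ssubset_iff_of_subset ?_ |>.2
      ⟨f, by simp [hf, hfx], by simp [hfu]⟩)
    intro g hg
    rw [Finset.mem_filter] at hg ⊢
    exact ⟨hg.1, fun h => hg.2 (hxu g hg.1 h)⟩
  rcases eq_or_ne x 0 with rfl | hx0
  · exact zero_mem C
  by_cases hface : (PointedCone.hull ℝ {x}).IsFaceOf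
      (PointedCone.dual (LinearMap.id : Module.Dual ℝ E →ₗ[ℝ] Module.Dual ℝ E)
        (S : Set (Module.Dual ℝ E)))
  · exact hC _ ⟨hface, x, hx0, rfl⟩ (mem_hull_singleton.2 ⟨1, zero_le_one, one_smul _ _⟩)
  obtain ⟨a, b, ha, hb, hab, hax⟩ : ∃ a b : E, (∀ f ∈ S, 0 ≤ f a) ∧ (∀ f ∈ S, 0 ≤ f b) ∧
      a + b ∈ PointedCone.hull ℝ {x} ∧ a ∉ PointedCone.hull ℝ {x} := by
    by_contra! h
    refine hface (PointedCone.IsFaceOf.of_mem_of_add_mem_left ?_ fun ha hb => h _ _ ha hb)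
    exact Submodule.span_le.2 (Set.singleton_subset_iff.2 hx)
  obtain ⟨c, hc, hcx⟩ := mem_hull_singleton.1 hab
  have hxa : ∀ f ∈ S, f x = 0 → f a = 0 := by
    intro f hf hfx
    have h1 := congrArg f hcx
    rw [map_smul, map_add, hfx, smul_zero] at h1
    linarith [ha f hf, hb f hf]
  -- Both `w = a - s • x` and `x - t • w` keep the constraints tight at `x` and gain a new one, and
  -- `x` is a nonnegative combination of them.
  obtain ⟨s, hs, hws, g, hg, hgx, hgw⟩ := exists_sub_smul_mem_dual hsal ha hx hx0
  set w := a - s • x with hw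
  have hxw : ∀ f ∈ S, f x = 0 → f w = 0 := fun f hf hfx => by simp [hw, hfx, hxa f hf hfx]
  have hw0 : w ≠ 0 := fun h => hax (mem_hull_singleton.2 ⟨s, hs, (sub_eq_zero.1 h).symm⟩)
  obtain ⟨t, ht, hut, k, hk, hkw, hku⟩ := exists_sub_smul_mem_dual hsal hx hws hw0
  have hwC : w ∈ C := key w hws hxw ⟨g, hg, hgx.ne', hgw⟩
  have huC : x - t • w ∈ C := key _ hut
    (fun f hf hfx => by simp [hfx, hxw f hf hfx]) ⟨k, hk, fun h => hkw.ne' (hxw k hk h), hku⟩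
  have := C.add_mem huC (C.smul_mem ht hwC)
  rwa [sub_add_cancel] at this

lemma GeneratesExtremeRays.hull_range_eq {ι : Type*} {K : PointedCone ℝ E} {x : ι → E}
    (hx : GeneratesExtremeRays K x) (hK : IsPolyhedral K) (hsal : ∀ z ∈ K, -z ∈ K → z = 0) :
    PointedCone.hull ℝ (Set.range x) = K := by
  refine le_antisymm (Submodule.span_le.2 ?_) (hK.le_of_extremeRay_le hsal fun R hR => ?_)
  · rintro _ ⟨i, rfl⟩
    exact (hx.mapsTo (Set.mem_univ i)).1.le (Submodule.mem_span_singleton_self _)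
  · obtain ⟨i, -, rfl⟩ := hx.surjOn hR
    exact Submodule.span_mono (Set.singleton_subset_iff.2 ⟨i, rfl⟩)

lemma GeneratesExtremeRays.ne_zero {ι : Type*} {K : PointedCone ℝ E} {x : ι → E}
    (hx : GeneratesExtremeRays K x) (i : ι) : x i ≠ 0 := by
  intro h
  obtain ⟨-, z, hz, hR⟩ := hx.mapsTo (Set.mem_univ i)
  have h1 : z ∈ PointedCone.hull ℝ {z} := Submodule.mem_span_singleton_self _
  rw [← hR] at h1
  obtain ⟨c, -, hc⟩ := mem_hull_singleton.1 h1
  exact hz (by rw [← hc, h, smul_zero])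

lemma GeneratesExtremeRays.eq_of_eq_smul {ι : Type*} {K : PointedCone ℝ E} {x : ι → E}
    (hx : GeneratesExtremeRays K x) {i j : ι} {c : ℝ} (hc : 0 < c) (h : x i = c • x j) :
    i = j := by
  refine hx.injOn (Set.mem_univ i) (Set.mem_univ j) (le_antisymm ?_ ?_) <;>
    refine Submodule.span_le.2 (Set.singleton_subset_iff.2 (mem_hull_singleton.2 ?_))
  · exact ⟨c, hc.le, h.symm⟩
  · exact ⟨c⁻¹, inv_nonneg.2 hc.le, by rw [h, inv_smul_smul₀ hc.ne']⟩

lemma IsSelfDual.eq_zero_of_neg_mem {K : PointedCone ℝ E} (hK : IsSelfDual K) {z : E}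
    (hz : z ∈ K) (hz' : -z ∈ K) : z = 0 := by
  obtain ⟨B, hB, hd⟩ := hK
  by_contra h
  rw [← hd] at hz'
  have := hz' hz
  rw [map_neg] at this
  linarith [hB.2 z h]

lemma IsInnerProduct.exists_eq_apply [FiniteDimensional ℝ E] {B : LinearMap.BilinForm ℝ E}
    (hB : IsInnerProduct B) (f : Module.Dual ℝ E) : ∃ z, ∀ x, B x z = f x := by
  have hinj : Function.Injective B := by
    rw [← LinearMap.ker_eq_bot, LinearMap.ker_eq_bot']
    intro m hm
    by_contra h
    have := hB.2 m h
    rw [hm] at this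
    exact lt_irrefl _ this
  obtain ⟨z, hz⟩ := (LinearMap.injective_iff_surjective_of_finrank_eq_finrank
    (Subspace.dual_finrank_eq (K := ℝ) (V := E)).symm).1 hinj f
  exact ⟨z, fun x => by rw [hB.1, hz]⟩

/-- A functional vanishing on `K` is represented by some `z` with both `z` and `-z` in the dual
cone, which is the salient cone `K`. -/
lemma IsSelfDual.span_eq_top [FiniteDimensional ℝ E] {K : PointedCone ℝ E} (hK : IsSelfDual K) :
    Submodule.span ℝ (K : Set E) = ⊤ := by
  obtain ⟨B, hB, hd⟩ := id hK
  by_contra hne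
  obtain ⟨v, hv⟩ : ∃ v, v ∉ Submodule.span ℝ (K : Set E) := by
    by_contra! h
    exact hne (eq_top_iff.2 fun v _ => h v)
  obtain ⟨f, hfv, hf⟩ := Submodule.exists_le_ker_of_notMem hv
  obtain ⟨z, hz⟩ := hB.exists_eq_apply f
  have h0 : ∀ x ∈ K, B x z = 0 := fun x hx => by
    rw [hz]
    exact hf (Submodule.subset_span hx)
  have hz0 : z = 0 := by
    refine hK.eq_zero_of_neg_mem ?_ ?_ <;> rw [← hd] <;> intro x hx
    · exact (h0 x hx).ge
    · rw [map_neg, h0 x hx, neg_zero]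
  exact hfv (by rw [← hz v, hz0, map_zero])

lemma span_hull (s : Set E) : Submodule.span ℝ (PointedCone.hull ℝ s : Set E) =
    Submodule.span ℝ s :=
  le_antisymm (Submodule.span_le.2 (PointedCone.hull_le_span (R := ℝ) s))
    (Submodule.span_mono PointedCone.subset_hull)

/-- If `y j` generates an extreme ray of the dual of the cone generated by `x`, then the generators
in the corresponding facet span the hyperplane orthogonal to `y j`. -/
lemma mem_span_of_apply_eq_zero [FiniteDimensional ℝ E] {ι : Type*} [Finite ι]
    {B : LinearMap.BilinForm ℝ E} (hB : IsInnerProduct B) {x : ι → E} {y : E}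
    (hy : (PointedCone.hull ℝ {y}).IsFaceOf (PointedCone.dual B (Set.range x))) {v : E}
    (hv : B v y = 0) : v ∈ Submodule.span ℝ (x '' {i | B (x i) y = 0}) := by
  by_contra hmem
  obtain ⟨f, hfv, hf⟩ := Submodule.exists_le_ker_of_notMem hmem
  obtain ⟨z, hz⟩ := hB.exists_eq_apply f
  have hyd : y ∈ PointedCone.dual B (Set.range x) :=
    hy.le (Submodule.mem_span_singleton_self _)
  -- Strict constraints survive a small perturbation of `y`; tight ones are unaffected because `z`
  -- vanishes on them.
  have hev : ∀ β : ℝ, ∀ i, (B (x i) y = 0 → β = 0) →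
      ∀ᶠ ε in 𝓝[>] (0 : ℝ), 0 ≤ B (x i) y + ε * β := by
    intro β i h
    rcases (hyd ⟨i, rfl⟩).eq_or_lt with h0 | h0
    · simp [← h0, h h0.symm]
    · have hc : Tendsto (fun ε : ℝ => B (x i) y + ε * β) (𝓝[>] 0) (𝓝 (B (x i) y + 0 * β)) :=
        ((by fun_prop : Continuous fun ε : ℝ => B (x i) y + ε * β).tendsto 0).mono_left
          nhdsWithin_le_nhds
      rw [zero_mul, add_zero] at hc
      exact (hc.eventually (lt_mem_nhds h0)).mono fun _ h => h.le
  have hz0 : ∀ i, B (x i) y = 0 → B (x i) z = 0 := fun i h => by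
    rw [hz]
    exact hf (Submodule.subset_span ⟨i, h, rfl⟩)
  obtain ⟨ε, hε, h⟩ := ((eventually_mem_nhdsWithin (a := (0 : ℝ)) (s := Set.Ioi 0)).and
    (eventually_all.2 fun i => (hev (B (x i) z) i (hz0 i)).and
      (hev (-B (x i) z) i fun h => neg_eq_zero.2 (hz0 i h)))).exists
  have hε : 0 < ε := hε
  -- `2 • y` is the sum of `y + ε • z` and `y - ε • z`, both in the dual cone, so both lie on the
  -- extreme ray; pairing with `v` then gives `ε * f v = 0`.
  have h1 : y + ε • z ∈ PointedCone.hull ℝ {y} := by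
    refine hy.mem_of_add_mem_left (y := y - ε • z) ?_ ?_ (mem_hull_singleton.2 ⟨2, by norm_num, ?_⟩)
    · rintro _ ⟨i, rfl⟩
      simpa using (h i).1
    · rintro _ ⟨i, rfl⟩
      have := (h i).2
      rw [map_sub, map_smul, smul_eq_mul]
      linarith
    · rw [two_smul]
      abel
  obtain ⟨c, -, hc⟩ := mem_hull_singleton.1 h1
  have h2 := congrArg (B v) hc
  rw [map_smul, map_add, map_smul, hv, hz, smul_zero, zero_add, smul_eq_mul, eq_comm,
    mul_eq_zero] at h2
  exact h2.elim hε.ne' hfv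

end Cones

/-! ### Trace factorizations of slack matrices -/

section Gram

open scoped MatrixOrder Matrix.Norms.L2Operator in
lemma exists_eq_conjTranspose_mul_self {k : ℕ} {A : Matrix (Fin k) (Fin k) ℝ}
    (hA : A.PosSemidef) : ∃ C : Matrix (Fin k) (Fin k) ℝ, A = C.conjTranspose * C :=
  CStarAlgebra.nonneg_iff_eq_star_mul_self.mp hA.nonneg

/-- Positive semidefinite matrices that are orthogonal for the trace inner product multiply to
zero. -/
lemma mul_eq_zero_of_trace_mul_eq_zero {k : ℕ} {A B : Matrix (Fin k) (Fin k) ℝ}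
    (hA : A.PosSemidef) (hB : B.PosSemidef) (h : (A * B).trace = 0) : A * B = 0 := by
  obtain ⟨C, rfl⟩ := exists_eq_conjTranspose_mul_self hA
  obtain ⟨D, rfl⟩ := exists_eq_conjTranspose_mul_self hB
  -- The trace of `A * B` is the squared Frobenius norm of `D * C.conjTranspose`.
  have h1 : ((D * C.conjTranspose).conjTranspose * (D * C.conjTranspose)).trace = 0 := by
    rw [← h, Matrix.conjTranspose_mul, Matrix.conjTranspose_conjTranspose]
    calc (C * D.conjTranspose * (D * C.conjTranspose)).trace
        = ((C * D.conjTranspose * D) * C.conjTranspose).trace := by simp only [Matrix.mul_assoc]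
      _ = _ := by rw [Matrix.trace_mul_comm]; simp only [Matrix.mul_assoc]
  have h2 := congrArg Matrix.conjTranspose (Matrix.trace_conjTranspose_mul_self_eq_zero_iff.1 h1)
  rw [Matrix.conjTranspose_mul, Matrix.conjTranspose_conjTranspose, Matrix.conjTranspose_zero] at h2
  calc C.conjTranspose * C * (D.conjTranspose * D)
      = C.conjTranspose * (C * D.conjTranspose) * D := by simp only [Matrix.mul_assoc]
    _ = 0 := by rw [h2, Matrix.mul_zero, Matrix.zero_mul]

lemma eq_zero_of_isHermitian_of_trace_mul_self {k : ℕ} {A : Matrix (Fin k) (Fin k) ℝ}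
    (hA : A.IsHermitian) (h : (A * A).trace = 0) : A = 0 :=
  Matrix.trace_conjTranspose_mul_self_eq_zero_iff.1 (by rwa [hA.eq])

variable {E : Type*} [AddCommGroup E] [Module ℝ E]

/-- A trace factorization of the pairing of a spanning family `x` with a family `y` extends
linearly from `x` to the whole space. -/
lemma exists_linearMap_of_gram {n k : ℕ} {B : LinearMap.BilinForm ℝ E} {x y : Fin n → E}
    (hspan : Submodule.span ℝ (Set.range x) = ⊤) {A : Fin n → Matrix (Fin k) (Fin k) ℝ}
    (hA : ∀ i, (A i).IsHermitian) (hBA : ∀ i j, B (x i) (y j) = (A i * A j).trace) :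
    ∃ L : E →ₗ[ℝ] Matrix (Fin k) (Fin k) ℝ, ∀ i, L (x i) = A i := by
  have hker : ∀ c : Fin n → ℝ, ∑ i, c i • x i = 0 → ∑ i, c i • A i = 0 := by
    intro c hc
    -- The combination is trace-orthogonal to every `A j`, hence to itself.
    have h1 : ∀ j, ((∑ i, c i • A i) * A j).trace = 0 := by
      intro j
      have := congrArg (fun v => B v (y j)) hc
      simp only [map_sum, map_smul, LinearMap.sum_apply, LinearMap.smul_apply, map_zero,
        LinearMap.zero_apply, hBA] at this
      simpa [Finset.sum_mul, Matrix.trace_sum] using this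
    refine eq_zero_of_isHermitian_of_trace_mul_self ?_ ?_
    · rw [Matrix.IsHermitian, Matrix.conjTranspose_sum]
      exact Finset.sum_congr rfl fun i _ => by
        rw [Matrix.conjTranspose_smul, (hA i).eq, star_trivial]
    · rw [Finset.mul_sum, Matrix.trace_sum]
      refine Finset.sum_eq_zero fun j _ => ?_
      rw [Matrix.mul_smul, Matrix.trace_smul, h1, smul_zero]
  have hr : LinearMap.range (Fintype.linearCombination ℝ x) = ⊤ := by
    rw [Fintype.range_linearCombination, hspan]
  obtain ⟨s, hs⟩ := LinearMap.exists_rightInverse_of_surjective _ hr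
  refine ⟨Fintype.linearCombination ℝ A ∘ₗ s, fun i => ?_⟩
  have h1 := hker (s (x i) - Pi.single i 1) (by
    have h2 := congrArg (fun g => g (x i)) hs
    have h3 := map_sub (Fintype.linearCombination ℝ x) (s (x i)) (Pi.single i 1)
    simp only [LinearMap.comp_apply, LinearMap.id_apply] at h2
    rw [h2, Fintype.linearCombination_apply_single, one_smul, sub_self] at h3
    exact h3)
  have h3 := map_sub (Fintype.linearCombination ℝ A) (s (x i)) (Pi.single i 1)
  rw [Fintype.linearCombination_apply_single, one_smul] at h3
  exact sub_eq_zero.1 (h3.symm.trans h1)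

/-- A pairing of the extreme rays of a spanning cone with those of its dual that is a trace Gram
matrix of positive semidefinite matrices vanishes off the diagonal. -/
lemma apply_eq_zero_of_ne [FiniteDimensional ℝ E] {n k : ℕ} {B : LinearMap.BilinForm ℝ E}
    (hB : IsInnerProduct B) {x y : Fin n → E} (hspan : Submodule.span ℝ (Set.range x) = ⊤)
    (hy : GeneratesExtremeRays (PointedCone.dual B (Set.range x)) y)
    {A : Fin n → Matrix (Fin k) (Fin k) ℝ} (hA : ∀ i, (A i).PosSemidef)
    (hBA : ∀ i j, B (x i) (y j) = (A i * A j).trace) :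
    (∀ j, B (x j) (y j) ≠ 0) ∧ ∀ i j, i ≠ j → B (x i) (y j) = 0 := by
  have hext : ∀ z, (∀ i, B (x i) z = 0) → z = 0 := by
    intro z hz
    have hle : Submodule.span ℝ (Set.range x) ≤ LinearMap.ker (B.flip z) :=
      Submodule.span_le.2 (by rintro _ ⟨i, rfl⟩; exact hz i)
    by_contra h
    have h1 : z ∈ LinearMap.ker (B.flip z) := hle (hspan ▸ Submodule.mem_top)
    exact (hB.2 z h).ne' h1
  have hdiag : ∀ j, B (x j) (y j) ≠ 0 := by
    intro j hj
    rw [hBA] at hj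
    have h0 := eq_zero_of_isHermitian_of_trace_mul_self (hA j).isHermitian hj
    exact hy.ne_zero j (hext _ fun i => by rw [hBA, h0, Matrix.mul_zero, Matrix.trace_zero])
  refine ⟨hdiag, ?_⟩
  obtain ⟨L, hL⟩ := exists_linearMap_of_gram hspan (fun i => (hA i).isHermitian) hBA
  have hLmul : ∀ v j, B v (y j) = 0 → L v * A j = 0 := by
    intro v j hv
    have hle : Submodule.span ℝ (x '' {i | B (x i) (y j) = 0}) ≤
        LinearMap.ker (LinearMap.mulRight ℝ (A j) ∘ₗ L) := by
      refine Submodule.span_le.2 ?_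
      rintro _ ⟨i, hi, rfl⟩
      simp only [SetLike.mem_coe, LinearMap.mem_ker, LinearMap.comp_apply,
        LinearMap.mulRight_apply, hL]
      exact mul_eq_zero_of_trace_mul_eq_zero (hA i) (hA j) (by rw [← hBA]; exact hi)
    exact hle (mem_span_of_apply_eq_zero hB (hy.mapsTo (Set.mem_univ j)).1 hv)
  have hdecomp : ∀ i j, ∃ W : Matrix (Fin k) (Fin k) ℝ, W * A j = 0 ∧ W.IsHermitian ∧
      A i = (B (x i) (y j) / B (x j) (y j)) • A j + W := by
    intro i j
    set α := B (x i) (y j) / B (x j) (y j) with hα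
    refine ⟨A i - α • A j, ?_, ?_, (add_sub_cancel _ _).symm⟩
    · have := hLmul (x i - α • x j) j (by
        rw [map_sub, map_smul, LinearMap.sub_apply, LinearMap.smul_apply, smul_eq_mul, hα,
          div_mul_cancel₀ _ (hdiag j), sub_self])
      rwa [map_sub, map_smul, hL, hL] at this
    · exact (hA i).isHermitian.sub (by
        rw [Matrix.IsHermitian, Matrix.conjTranspose_smul, (hA j).isHermitian.eq, star_trivial])
  have hnonneg : ∀ i j, 0 ≤ B (x i) (y j) := fun i j =>
    (hy.mapsTo (Set.mem_univ j)).1.le (Submodule.mem_span_singleton_self _) ⟨i, rfl⟩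
  intro i j hij
  by_contra hne
  -- Symmetry of the trace makes both coefficients `α` and `β` positive.
  have hsymm : B (x j) (y i) = B (x i) (y j) := by rw [hBA, hBA, Matrix.trace_mul_comm]
  have hα : 0 < B (x i) (y j) / B (x j) (y j) :=
    div_pos ((hnonneg i j).lt_of_ne' hne) ((hnonneg j j).lt_of_ne' (hdiag j))
  have hβ : 0 < B (x j) (y i) / B (x i) (y i) :=
    div_pos (hsymm ▸ (hnonneg i j).lt_of_ne' hne) ((hnonneg i i).lt_of_ne' (hdiag i))
  obtain ⟨W, hW, hWh, hi⟩ := hdecomp i j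
  obtain ⟨V, hV, -, hj⟩ := hdecomp j i
  set α := B (x i) (y j) / B (x j) (y j)
  set β := B (x j) (y i) / B (x i) (y i)
  have hW' : A j * W = 0 := by
    have := congrArg Matrix.conjTranspose hW
    rwa [Matrix.conjTranspose_mul, hWh.eq, (hA j).isHermitian.eq,
      Matrix.conjTranspose_zero] at this
  have hiW : A i * W = W * W := by rw [hi, add_mul, Matrix.smul_mul, hW', smul_zero, zero_add]
  have hji : A j * A i = β • (A i * A i) := by
    conv_lhs => rw [hj, add_mul, hV, add_zero, Matrix.smul_mul]
  -- Evaluate `A j * A i * W` in two ways: it is `A j * (W * W) = 0`, and also `β • (A i * A i * W)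
  -- = β • (W * W * W)`.
  have hWWW : W * W * W = 0 := by
    have h1 : A j * A i * W = 0 := by
      rw [Matrix.mul_assoc, hiW, ← Matrix.mul_assoc, hW', Matrix.zero_mul]
    rw [hji, Matrix.smul_mul, smul_eq_zero, or_iff_right hβ.ne', Matrix.mul_assoc, hiW,
      ← Matrix.mul_assoc, hiW] at h1
    exact h1
  have hWW : W * W = 0 := by
    refine eq_zero_of_isHermitian_of_trace_mul_self ?_ ?_
    · rw [Matrix.IsHermitian, Matrix.conjTranspose_mul, hWh.eq]
    · rw [← Matrix.mul_assoc, hWWW, Matrix.zero_mul, Matrix.trace_zero]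
  have hW0 : W = 0 := eq_zero_of_isHermitian_of_trace_mul_self hWh (by rw [hWW, Matrix.trace_zero])
  rw [hW0, add_zero] at hi
  -- From `A i = α • A j`, the vectors `y i` and `α • y j` pair equally with every `x l`, hence
  -- coincide.
  refine hij (hy.eq_of_eq_smul hα (sub_eq_zero.1 (hext _ fun l => ?_)))
  rw [map_sub, map_smul, hBA, hBA, hi, Matrix.mul_smul, Matrix.trace_smul, sub_self]

/-- Since the pairing is diagonal with nonzero diagonal, pairing a linear relation among the `x i`
with `y j` isolates its `j`-th coefficient. -/
lemma isSimplicial_of_isCompletelyPosSemidef [FiniteDimensional ℝ E] {K : PointedCone ℝ E}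
    (hpoly : IsPolyhedral K) (hself : IsSelfDual K) {n : ℕ} {M : Matrix (Fin n) (Fin n) ℝ}
    (hM : IsSlackMatrix K M) (hcp : IsCompletelyPosSemidef M) : K.IsSimplicial := by
  obtain ⟨B, hB, x, y, hx, hy, hMB⟩ := hM
  obtain ⟨k, A, hA, hMA⟩ := hcp
  have hK := hx.hull_range_eq hpoly fun z hz hz' => hself.eq_zero_of_neg_mem hz hz'
  have hspan : Submodule.span ℝ (Set.range x) = ⊤ := by
    rw [← span_hull, hK, hself.span_eq_top]
  rw [← hK, PointedCone.dual_hull] at hy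
  obtain ⟨hd, ho⟩ := apply_eq_zero_of_ne hB hspan hy hA fun i j => (hMB i j).symm.trans (hMA i j)
  refine ⟨Set.range x, Set.finite_range x, LinearIndependent.linearIndepOn_id ?_, hK⟩
  rw [Fintype.linearIndependent_iff]
  intro c hc j
  have h1 := congrArg (fun v => B v (y j)) hc
  simp only [map_sum, map_smul, LinearMap.sum_apply, LinearMap.smul_apply, map_zero,
    LinearMap.zero_apply, smul_eq_mul] at h1
  rw [Finset.sum_eq_single j (fun i _ hij => by rw [ho i j hij, mul_zero]) (by simp)] at h1
  exact (mul_eq_zero.1 h1).resolve_right (hd j)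

end Gram

/-! ### Simplicial cones are reducible -/

section Irreducible

variable {E : Type*} [NormedAddCommGroup E] [NormedSpace ℝ E] [FiniteDimensional ℝ E]

lemma isClosed_hull_image_basis {ι : Type*} [Finite ι] (b : Module.Basis ι ℝ E) (J : Set ι) :
    IsClosed (PointedCone.hull ℝ (b '' J) : Set E) := by
  classical
  cases nonempty_fintype ι
  -- In coordinates the cone is an orthant of a coordinate subspace, cut out by closed conditions.
  have h : (PointedCone.hull ℝ (b '' J) : Set E) =
      ⋂ i, {v | 0 ≤ b.coord i v ∧ (i ∉ J → b.coord i v = 0)} := by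
    ext v
    simp only [Set.mem_iInter, Set.mem_ofPred_eq, SetLike.mem_coe]
    constructor
    · intro hv
      induction hv using Submodule.span_induction with
      | mem v hv =>
        obtain ⟨j, hj, rfl⟩ := hv
        intro i
        rw [b.coord_apply, b.repr_self, Finsupp.single_apply]
        split_ifs with hij
        · exact ⟨zero_le_one, fun h => absurd (hij ▸ hj) h⟩
        · simp
      | zero => simp
      | add u v _ _ hu hv =>
        intro i
        rw [map_add]
        exact ⟨add_nonneg (hu i).1 (hv i).1, fun h => by rw [(hu i).2 h, (hv i).2 h, add_zero]⟩
      | smul c v _ hv =>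
        intro i
        rw [show c • v = (c : ℝ) • v from rfl, map_smul, smul_eq_mul]
        exact ⟨mul_nonneg c.2 (hv i).1, fun h => by rw [(hv i).2 h, mul_zero]⟩
    · intro hv
      rw [← b.sum_repr v]
      refine Submodule.sum_mem _ fun i _ => ?_
      by_cases hi : i ∈ J
      · exact PointedCone.smul_mem _ (hv i).1 (PointedCone.subset_hull ⟨i, hi, rfl⟩)
      · have h0 : b.repr v i = 0 := (hv i).2 hi
        rw [h0, zero_smul]
        exact zero_mem _
  rw [h]
  refine isClosed_iInter fun i => ?_
  have hc : Continuous (b.coord i) := LinearMap.continuous_of_finiteDimensional _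
  rw [Set.ofPred_and]
  refine (isClosed_le continuous_const hc).inter ?_
  by_cases hi : i ∈ J
  · simp [hi]
  · simpa [hi] using isClosed_eq hc continuous_const

/-- The independent generators form a basis with at least two elements; splitting off one of them
decomposes the cone. -/
lemma not_isIrreducible_of_isSimplicial (hE : 2 ≤ Module.finrank ℝ E) {K : PointedCone ℝ E}
    (hspan : Submodule.span ℝ (K : Set E) = ⊤) (hK : K.IsSimplicial) : ¬ IsIrreducible K := by
  obtain ⟨s, hs, hli, rfl⟩ := hK
  rw [span_hull] at hspan
  have := hs.to_subtype
  let b : Module.Basis s ℝ E := Module.Basis.mk hli (by simp [hspan])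
  have hb : ∀ i, b i = i := fun i => by simp [b]
  have hcard : 1 < Nat.card s := by
    rw [← Module.finrank_eq_nat_card_basis b]
    exact hE
  obtain ⟨a, c, hac⟩ := (Finite.one_lt_card_iff_nontrivial.1 hcard).exists_pair_ne
  have hne : ∀ (J : Set s) (j : s), j ∈ J → PointedCone.hull ℝ (b '' J) ≠ ⊥ := by
    intro J j hj h
    have h1 : b j ∈ PointedCone.hull ℝ (b '' J) := PointedCone.subset_hull ⟨j, hj, rfl⟩
    rw [h, Submodule.mem_bot] at h1
    exact b.ne_zero j h1
  rw [IsIrreducible, not_not]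
  refine ⟨PointedCone.hull ℝ (b '' {a}), PointedCone.hull ℝ (b '' {a}ᶜ),
    isClosed_hull_image_basis b _, isClosed_hull_image_basis b _, hne _ a rfl,
    hne _ c hac.symm, ?_, ?_⟩
  · rw [span_hull, span_hull]
    exact (b.linearIndependent.disjoint_span_image disjoint_compl_right).eq_bot
  · rw [PointedCone.hull, PointedCone.hull, PointedCone.hull, ← Submodule.span_union,
      ← Set.image_union, Set.union_compl_self, Set.image_univ]
    congr 1
    ext v
    simp [hb]

end Irreducible

end ConeSlack

theorem mainTheorem4 (d : ℕ) (hd : 3 ≤ d) (K : PointedCone ℝ (EuclideanSpace ℝ (Fin d)))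
    (hpoly : ConeSlack.IsPolyhedral K) (hself : ConeSlack.IsSelfDual K) :
    (¬ K.IsSimplicial →
      ∀ (n : ℕ) (M : Matrix (Fin n) (Fin n) ℝ),
        ConeSlack.IsSlackMatrix K M → M.PosSemidef → ¬ ConeSlack.IsCompletelyPosSemidef M) ∧
    (ConeSlack.IsIrreducible K →
      ¬ K.IsSimplicial ∧
      ∀ (n : ℕ) (M : Matrix (Fin n) (Fin n) ℝ),
        ConeSlack.IsSlackMatrix K M → M.PosSemidef → ¬ ConeSlack.IsCompletelyPosSemidef M) := by
  have h : ∀ (n : ℕ) (M : Matrix (Fin n) (Fin n) ℝ), ¬ K.IsSimplicial →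
      ConeSlack.IsSlackMatrix K M → M.PosSemidef → ¬ ConeSlack.IsCompletelyPosSemidef M :=
    fun n M hK hM _ hcp =>
      hK (ConeSlack.isSimplicial_of_isCompletelyPosSemidef hpoly hself hM hcp)
  refine ⟨fun hK n M => h n M hK, fun hirr => ?_⟩
  have hK : ¬ K.IsSimplicial := fun hK =>
    ConeSlack.not_isIrreducible_of_isSimplicial (by rw [finrank_euclideanSpace_fin]; omega)
      hself.span_eq_top hK hirr
  exact ⟨hK, fun n M => h n M hK⟩
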